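/- Conventions. Graphs are 1-dimensional cell complexes; $E\Gamma$ is the set of oriented edges of $\Gamma$, $o(e)$ is the initial vertex of $e$, and an edge-path is tight if it contains no subpath $e\,e^{-1}$. A graph-map $f:\Gamma\to\Gamma$ sends vertices to vertices and every edge to a tight edge-path of positive length. Let $F_N=\pi_1(R_N)$, where $R_N$ is the rose with $N$ petals. A train-track representative of $\varphi\in\mathrm{Out}(F_N)$ consists of a finite connected graph $\Gamma$ all of whose vertices have degree at least $3$, a homotopy equivalence $\alpha:R_N\to\Gamma$ (the marking) and a graph-map $f:\Gamma\to\Gamma$ that is a homotopy equivalence, such that $\beta\circ f\circ\alpha$ induces $\varphi$ for a homotopy inverse $\beta$ of $\alpha$, and such that $f^n(e)$ is tight for every edge $e$ and every $n\ge 1$. The transition matrix $A(f)$ is indexed by the unoriented edges $e_1,\dots,e_r$ of $\Gamma$ (each given some orientation); its $(i,j)$ entry is the number of occurrences of $e_i^{\pm1}$ in $f(e_j)$. We write $A(f)>0$ if all its entries are positive. For a vertex $v$, the Whitehead graph $Wh_\Gamma(v,f)$ is the simple graph whose vertices are the oriented edges $e$ of $\Gamma$ with $o(e)=v$; distinct $e',e''$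 are adjacent if for some edge $e$ and some $n\ge1$ the path $f^n(e)$ contains $(e')^{-1}e''$ or $(e'')^{-1}e'$ as a subpath. The stable lamination $\Lambda(f)$ is the set of bi-infinite edge-paths $\dots,e_{-1},e_0,e_1,\dots$ in $\Gamma$ (its leaves) such that for all integers $i\le j$ there are $n\ge1$ and $e\in E\Gamma$ for which $e_i,\dots,e_j$ is a subpath of $f^n(e)$. For a nontrivial finitely generated subgroup $H\le F_N$, let $\widehat\Gamma\to\Gamma$ be the covering corresponding to $H$ (with $F_N$ identified with $\pi_1(\Gamma)$ through $\alpha$) and let the Stallings core $\Delta_H$ be the smallest finite connected subgraph of $\widehat\Gamma$ whose inclusion in $\widehat\Gamma$ is a homotopy equivalence. We say that $H$ carries a leaf of $\Lambda(f)$ if some leaf of $\Lambda(f)$ lifts to a bi-infinite edge-path in $\Delta_H$. Proposition 4.2. Let $N\ge 2$, let $\varphi\in\mathrm{Out}(F_N)$, and let $f:\Gamma\to\Gamma$ be a train-track representative of $\varphi$ such that $A(f)>0$. Suppose that for every vertex $v$ of $\Gamma$ the Whitehead graph $Wh_\Gamma(v,f)$ is connected. Then there is no finitely generated subgroup of infinite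 index in $F_N$ that carries a leaf of $\Lambda(f)$. -/

import Mathlib

namespace TrainTrack

/-- A graph, i.e. a 1-dimensional cell complex with 0-cells `V` and 1-cells (topological edges)
`E`. Each topological edge comes with the orientation given by its characteristic map, running
from `src` to `tgt`; loops and multiple edges are allowed. -/
structure CellGraph (V E : Type*) where
  src : E → V
  tgt : E → V

/-- Oriented edges: `(e, true)` is `e` with its chosen orientation and `(e, false)` is `e⁻¹`. -/
abbrev OEdge (E : Type*) := E × Bool

namespace CellGraph

variable {V E V' E' V'' E'' : Type*}

/-- Initial vertex of an oriented edge. -/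
def o (Γ : CellGraph V E) (e : OEdge E) : V := if e.2 then Γ.src e.1 else Γ.tgt e.1

/-- Terminal vertex of an oriented edge. -/
def t (Γ : CellGraph V E) (e : OEdge E) : V := if e.2 then Γ.tgt e.1 else Γ.src e.1

/-- The same edge with the opposite orientation. -/
def _root_.TrainTrack.OEdge.inv (e : OEdge E) : OEdge E := (e.1, !e.2)

/-- `l` is an edge-path from `u` to `v`; the empty list is the path of length zero at a vertex.
The inverse path is `FreeGroup.invRev l`. Tight paths are those with `FreeGroup.IsReduced l`.
As an elementary cancellation `e e⁻¹` in an edge-path leaves an edge-path with the same endpoints,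
and reduced forms are unique, two edge-paths with the same endpoints are homotopic relative to
their endpoints if and only if they have the same class in the free group on the set of
topological edges. -/
def IsPath (Γ : CellGraph V E) : V → V → List (OEdge E) → Prop
  | u, v, [] => u = v
  | u, v, e :: l => Γ.o e = u ∧ Γ.IsPath (Γ.t e) v l

/-- A graph is connected if it is nonempty and any two vertices are joined by an edge-path. -/
def Connected (Γ : CellGraph V E) : Prop :=
  Nonempty V ∧ ∀ u v, ∃ l, Γ.IsPath u v l

/-- The degree of a vertex: the number of oriented edges issuing from it
(so that a loop counts twice). -/
noncomputable def degree (Γ : CellGraph V E) (v : V) : ℕ :=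
  Nat.card {e : OEdge E // Γ.o e = v}

theorem IsPath.append {Γ : CellGraph V E} {l l' : List (OEdge E)} :
    ∀ {u v w : V}, Γ.IsPath u v l → Γ.IsPath v w l' → Γ.IsPath u w (l ++ l') := by
  induction l with
  | nil => intro u v w h h'; cases h; exact h'
  | cons e l ih => intro u v w h h'; exact ⟨h.1, ih h.2 h'⟩

theorem IsPath.invRev {Γ : CellGraph V E} {l : List (OEdge E)} :
    ∀ {u v : V}, Γ.IsPath u v l → Γ.IsPath v u (FreeGroup.invRev l) := by
  induction l with
  | nil => intro u v h; exact Eq.symm h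
  | cons e l ih =>
    intro u v h
    rw [FreeGroup.invRev_cons]
    refine (ih h.2).append ?_
    rcases e with ⟨e, b⟩
    have h1 := h.1
    cases b <;> simp_all [FreeGroup.invRev, IsPath, o, t]

end CellGraph

open CellGraph

variable {V E V' E' V'' E'' : Type*}

/-- A combinatorial map between graphs: vertices go to vertices and every edge goes to an
edge-path, which may have length zero and need not be tight. Up to homotopy these are all the
continuous maps between graphs. -/
structure CellMap (Γ : CellGraph V E) (Γ' : CellGraph V' E') where
  vert : V → V'
  edge : E → List (OEdge E')
  edge_path : ∀ e, Γ'.IsPath (vert (Γ.src e)) (vert (Γ.tgt e)) (edge e)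

namespace CellMap

variable {Γ : CellGraph V E} {Γ' : CellGraph V' E'} {Γ'' : CellGraph V'' E''}

/-- Image of an oriented edge: the image of `e⁻¹` is the inverse of the image of `e`. -/
def oedge (f : CellMap Γ Γ') (e : OEdge E) : List (OEdge E') :=
  if e.2 then f.edge e.1 else FreeGroup.invRev (f.edge e.1)

/-- Image of an edge-path, without tightening. -/
def path (f : CellMap Γ Γ') (l : List (OEdge E)) : List (OEdge E') := l.flatMap f.oedge

theorem path_isPath (f : CellMap Γ Γ') {l : List (OEdge E)} :
    ∀ {u v : V}, Γ.IsPath u v l → Γ'.IsPath (f.vert u) (f.vert v) (f.path l) := by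
  induction l with
  | nil => intro u v h; exact congrArg f.vert h
  | cons e l ih =>
    intro u v h
    obtain ⟨h1, h2⟩ := h
    subst h1
    refine IsPath.append (v := f.vert (Γ.t e)) ?_ (ih h2)
    rcases e with ⟨e, b⟩
    cases b
    · simpa [oedge, o, t] using (f.edge_path e).invRev
    · simpa [oedge, o, t] using f.edge_path e

/-- The identity map. -/
def id (Γ : CellGraph V E) : CellMap Γ Γ where
  vert v := v
  edge e := [(e, true)]
  edge_path e := by simp [IsPath, o, t]

/-- The composition `g ∘ f`. -/
def comp (g : CellMap Γ' Γ'') (f : CellMap Γ Γ') : CellMap Γ Γ'' where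
  vert v := g.vert (f.vert v)
  edge e := g.path (f.edge e)
  edge_path e := g.path_isPath (f.edge_path e)

/-- Action of a map on homotopy classes of edge-paths, written in the free groups on the sets of
topological edges. -/
def hom (f : CellMap Γ Γ') : FreeGroup E →* FreeGroup E' :=
  FreeGroup.lift fun e => FreeGroup.mk (f.edge e)

/-- Homotopy of maps: the vertices move along edge-paths `p v` from `f v` to `g v`, and for every
edge `e` from `u` to `v` the square with sides `f e`, `p v`, `p u`, `g e` can be filled in. -/
def Homotopic (f g : CellMap Γ Γ') : Prop :=
  ∃ p : V → List (OEdge E'), (∀ v, Γ'.IsPath (f.vert v) (g.vert v) (p v)) ∧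
    ∀ e : E, FreeGroup.mk (f.edge e ++ p (Γ.tgt e)) = FreeGroup.mk (p (Γ.src e) ++ g.edge e)

/-- `g` is a homotopy inverse of `f`. -/
def IsHomotopyInverse (f : CellMap Γ Γ') (g : CellMap Γ' Γ) : Prop :=
  Homotopic (g.comp f) (CellMap.id Γ) ∧ Homotopic (f.comp g) (CellMap.id Γ')

/-- `f` is a homotopy equivalence. -/
def IsHomotopyEquiv (f : CellMap Γ Γ') : Prop := ∃ g : CellMap Γ' Γ, f.IsHomotopyInverse g

/-- `f` is a graph-map: every edge is mapped to a tight edge-path of positive length. -/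
def IsGraphMap (f : CellMap Γ Γ') : Prop :=
  ∀ e : E, f.edge e ≠ [] ∧ FreeGroup.IsReduced (f.edge e)

/-- The path `fⁿ(e)`, for an oriented edge `e`. -/
def iter (f : CellMap Γ Γ) (n : ℕ) (e : OEdge E) : List (OEdge E) := f.path^[n] [e]

open Classical in
/-- The transition matrix `A(f)`, whose `(i, j)` entry is the number of occurrences of `i` and
`i⁻¹` in the path `f(j)`. -/
noncomputable def transitionMatrix (f : CellMap Γ Γ) : Matrix E E ℕ :=
  fun i j => ((f.edge j).map Prod.fst).count i

/-- `f` is a train-track map: a graph-map such that `fⁿ(e)` is tight for all `n ≥ 1` and all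
oriented edges `e`. -/
def IsTrainTrack (f : CellMap Γ Γ) : Prop :=
  f.IsGraphMap ∧ ∀ (e : OEdge E) (n : ℕ), 1 ≤ n → FreeGroup.IsReduced (f.iter n e)

end CellMap

/-- The turn `{e, e'}` is contained in the edge-path `l`. -/
def ContainsTurn (l : List (OEdge E)) (e e' : OEdge E) : Prop :=
  [e.inv, e'] <:+: l ∨ [e'.inv, e] <:+: l

/-- The turn `{e, e'}` is taken by `f`. -/
def Taken {Γ : CellGraph V E} (f : CellMap Γ Γ) (e e' : OEdge E) : Prop :=
  Γ.o e = Γ.o e' ∧ ∃ n : ℕ, 1 ≤ n ∧ ∃ e'' : OEdge E, ContainsTurn (f.iter n e'') e e'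

/-- The Whitehead graph of `f` at the vertex `v`: its vertices are the oriented edges with origin
`v`, and distinct ones are adjacent if they form a turn taken by `f`. -/
def whiteheadGraph {Γ : CellGraph V E} (f : CellMap Γ Γ) (v : V) :
    SimpleGraph {e : OEdge E // Γ.o e = v} where
  Adj e e' := e ≠ e' ∧ Taken f e.1 e'.1
  symm := ⟨fun _ _ h => ⟨h.1.symm, h.2.1.symm, by
    obtain ⟨n, hn, e'', h'⟩ := h.2.2
    exact ⟨n, hn, e'', h'.symm⟩⟩⟩
  loopless := ⟨fun _ h => h.1 rfl⟩

/-- The segment `e_i, ..., e_j` of a bi-infinite sequence of oriented edges. -/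
def segment (γ : ℤ → OEdge E) (i j : ℤ) : List (OEdge E) :=
  (List.range (j - i + 1).toNat).map fun k => γ (i + k)

/-- A bi-infinite edge-path. -/
def IsBiinfinitePath (Γ : CellGraph V E) (γ : ℤ → OEdge E) : Prop :=
  ∀ i, Γ.t (γ i) = Γ.o (γ (i + 1))

/-- The stable lamination `Λ(f)`: its leaves are the bi-infinite edge-paths all of whose finite
segments are subpaths of paths `fⁿ(e)`. -/
def stableLamination {Γ : CellGraph V E} (f : CellMap Γ Γ) : Set (ℤ → OEdge E) :=
  {γ | IsBiinfinitePath Γ γ ∧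
    ∀ i j : ℤ, i ≤ j → ∃ n : ℕ, 1 ≤ n ∧ ∃ e : OEdge E, segment γ i j <:+: f.iter n e}

/-- The rose `R_N`: one vertex and `N` loops. Its fundamental group is identified with the free
group `F_N = FreeGroup (Fin N)`, the `i`-th loop corresponding to the `i`-th generator. -/
def rose (N : ℕ) : CellGraph Unit (Fin N) where
  src _ := ()
  tgt _ := ()

instance innNormal (G : Type*) [Group G] :
    ((MulAut.conj : G →* MulAut G).range).Normal where
  conj_mem := by
    rintro _ ⟨g, rfl⟩ Φ
    exact ⟨Φ g, by ext x; simp⟩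

/-- The outer automorphism group of a group. -/
abbrev Out (G : Type*) [Group G] := MulAut G ⧸ (MulAut.conj : G →* MulAut G).range

/-- The self-map `g` of the rose induces the outer automorphism `φ` of `F_N`. -/
def Induces {N : ℕ} (g : CellMap (rose N) (rose N)) (φ : Out (FreeGroup (Fin N))) : Prop :=
  ∃ Φ : MulAut (FreeGroup (Fin N)), (Φ : Out (FreeGroup (Fin N))) = φ ∧
    Φ.toMonoidHom = g.hom

/-- The map `f`, together with the marking `α : R_N → Γ`, is a topological representative
of `φ`. -/
structure IsTopologicalRepresentative {N : ℕ} (φ : Out (FreeGroup (Fin N)))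
    {Γ : CellGraph V E} (α : CellMap (rose N) Γ) (f : CellMap Γ Γ) : Prop where
  finite_vert : Finite V
  finite_edge : Finite E
  connected : Γ.Connected
  graphMap : f.IsGraphMap
  homotopyEquiv : f.IsHomotopyEquiv
  marking : ∃ β : CellMap Γ (rose N), α.IsHomotopyInverse β ∧ Induces (β.comp (f.comp α)) φ

/-- The map `f`, together with the marking `α : R_N → Γ`, is a train-track representative
of `φ`. -/
structure IsTrainTrackRepresentative {N : ℕ} (φ : Out (FreeGroup (Fin N)))
    {Γ : CellGraph V E} (α : CellMap (rose N) Γ) (f : CellMap Γ Γ) : Prop extends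
    IsTopologicalRepresentative φ α f where
  trainTrack : f.IsTrainTrack
  three_le_degree : ∀ v, 3 ≤ Γ.degree v

/-! The covering of `Γ` corresponding to a subgroup `H` of `F_N = π₁(Γ, v₀)`, where `v₀` is the
image of the vertex of the rose and the identification is given by the marking. -/

/-- The image of `H` in the group of homotopy classes of edge-paths from `v₀` to `v₀`, as a
subgroup of the free group on the set of topological edges. -/
def markedSubgroup {N : ℕ} {Γ : CellGraph V E} (α : CellMap (rose N) Γ)
    (H : Subgroup (FreeGroup (Fin N))) : Subgroup (FreeGroup E) := H.map α.hom

/-- Vertices of the covering corresponding to `H`, with the usual construction: edge-paths `l`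
from `v₀` to some vertex `v`, where `l` and `l'` give the same vertex if they have the same
endpoint and `l l'⁻¹` represents an element of `H`. The class of `l` is recorded as the pair
consisting of its endpoint and the left coset of `l⁻¹`. -/
def CoverVert {N : ℕ} {Γ : CellGraph V E} (α : CellMap (rose N) Γ)
    (H : Subgroup (FreeGroup (Fin N))) :=
  {x : V × (FreeGroup E ⧸ markedSubgroup α H) //
    ∃ l : List (OEdge E), Γ.IsPath (α.vert ()) x.1 l ∧
      x.2 = (((FreeGroup.mk l)⁻¹ : FreeGroup E) : FreeGroup E ⧸ markedSubgroup α H)}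

/-- Topological edges of the covering: over an edge `e` of `Γ` there is one edge issuing from
each vertex over the origin of `e`. -/
def CoverEdge {N : ℕ} {Γ : CellGraph V E} (α : CellMap (rose N) Γ)
    (H : Subgroup (FreeGroup (Fin N))) :=
  {y : CoverVert α H × E // y.1.1.1 = Γ.src y.2}

/-- The covering of `Γ` corresponding to `H`: the lift of `e` at the class of `l` ends at the
class of `l e`. -/
def cover {N : ℕ} {Γ : CellGraph V E} (α : CellMap (rose N) Γ)
    (H : Subgroup (FreeGroup (Fin N))) : CellGraph (CoverVert α H) (CoverEdge α H) where
  src y := y.1.1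
  tgt y := ⟨(Γ.tgt y.1.2, (FreeGroup.of y.1.2)⁻¹ • y.1.1.1.2), by
    obtain ⟨⟨⟨⟨v, c⟩, l, hl, hc⟩, e⟩, he⟩ := y
    refine ⟨l ++ [(e, true)], hl.append ⟨he.symm, rfl⟩, ?_⟩
    dsimp only at hc ⊢
    rw [hc, ← FreeGroup.mul_mk, mul_inv_rev]
    rfl⟩

/-- The covering map on oriented edges. -/
def coverProj {N : ℕ} {Γ : CellGraph V E} (α : CellMap (rose N) Γ)
    (H : Subgroup (FreeGroup (Fin N))) (e : OEdge (CoverEdge α H)) : OEdge E :=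
  (e.1.1.2, e.2)

/-- A subgraph of a graph. -/
structure CellSubgraph (Γ : CellGraph V E) where
  verts : Set V
  edges : Set E
  src_mem : ∀ e ∈ edges, Γ.src e ∈ verts
  tgt_mem : ∀ e ∈ edges, Γ.tgt e ∈ verts

namespace CellSubgraph

variable {Γ : CellGraph V E}

/-- A subgraph as a graph. -/
def coe (Δ : CellSubgraph Γ) : CellGraph Δ.verts Δ.edges where
  src e := ⟨Γ.src e.1, Δ.src_mem e.1 e.2⟩
  tgt e := ⟨Γ.tgt e.1, Δ.tgt_mem e.1 e.2⟩

/-- The inclusion of a subgraph. -/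
def incl (Δ : CellSubgraph Γ) : CellMap Δ.coe Γ where
  vert v := v.1
  edge e := [(e.1, true)]
  edge_path e := by simp [IsPath, o, t, coe]

/-- `Δ` is a finite connected subgraph whose inclusion is a homotopy equivalence. -/
def IsFiniteDeformation (Δ : CellSubgraph Γ) : Prop :=
  Δ.verts.Finite ∧ Δ.edges.Finite ∧ Δ.coe.Connected ∧ Δ.incl.IsHomotopyEquiv

/-- `Δ` is the smallest finite connected subgraph whose inclusion is a homotopy equivalence. -/
def IsCore (Δ : CellSubgraph Γ) : Prop :=
  Δ.IsFiniteDeformation ∧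
    ∀ Δ' : CellSubgraph Γ, Δ'.IsFiniteDeformation →
      Δ.verts ⊆ Δ'.verts ∧ Δ.edges ⊆ Δ'.edges

end CellSubgraph

/-- The nontrivial finitely generated subgroup `H` carries a leaf of `Λ(f)`: some leaf lifts to a
bi-infinite edge-path in the Stallings core of `H`, i.e. in the smallest finite connected
subgraph of the covering corresponding to `H` whose inclusion is a homotopy equivalence. -/
def CarriesLeaf {N : ℕ} {Γ : CellGraph V E} (α : CellMap (rose N) Γ) (f : CellMap Γ Γ)
    (H : Subgroup (FreeGroup (Fin N))) : Prop :=
  H ≠ ⊥ ∧ H.FG ∧ ∃ Δ : CellSubgraph (cover α H), Δ.IsCore ∧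
    ∃ γ ∈ stableLamination f, ∃ γ' : ℤ → OEdge (CoverEdge α H),
      IsBiinfinitePath (cover α H) γ' ∧
        ∀ i, (γ' i).1 ∈ Δ.edges ∧ coverProj α H (γ' i) = γ i

end TrainTrack

namespace TrainTrack

open CellGraph

variable {V E V' E' V'' E'' : Type*}

/-! ### Blocks in concatenations of words -/

/-! Let D be the finite edge set of a core into which a leaf lifts, and for an edge-path count the
sheets from which it lifts into D. The count is finite for a nonempty path, is unchanged by
inversion, and cannot grow when the path is extended.

Since A(f) > 0, every later iterate of an edge contains f^n(b) or its inverse, so the counts of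
f^n(e) become a constant c independent of n and e (`exists_ncard_lifts_iter_eq`). If a turn {a, b}
is taken, then f^n(a)⁻¹ f^n(b) lies in a later iterate and still has at least c lifts, so f^n(a) and
f^n(b) lift from the same c sheets. Connectedness of the Whitehead graphs spreads this to all edges
at a vertex v (`lifts_iter_eq_of_o_eq`) and gives a finite set S_v of sheets over f^n(v).

Lifting f^n(l), for a path l from u to v, carries S_u into S_v (`inv_smul_mem_lifts_of_isPath`). A
homotopy equivalence is onto on loops (`exists_loop_iterate`), so S_v is invariant under every loop
at f^n(v). The leaf contains some f^n(e), so S_v is nonempty for v = o(e). A nonempty finite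
invariant set of sheets forces finite index (`index_ne_zero_of_loops`). -/

theorem exists_prefix_of_prefix_flatMap {A B : Type*} (F : A → List B) {C : ℕ}
    (hF : ∀ a, (F a).length ≤ C) {s : List B} (hs : C < s.length) {l : List A}
    (h : s <+: l.flatMap F) : ∃ a ∈ l, F a <+: s := by
  cases l with
  | nil =>
    have := h.length_le
    rw [List.flatMap_nil, List.length_nil] at this
    omega
  | cons a l =>
    refine ⟨a, by simp, ?_⟩
    rw [List.flatMap_cons] at h
    exact List.prefix_of_prefix_length_le (List.prefix_append _ _) h ((hF a).trans hs.le)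

/-- A window longer than two blocks loses at most C letters to the block in which it starts; the
more than C letters left begin at a block boundary and cover the next block. -/
theorem exists_infix_of_infix_flatMap {A B : Type*} (F : A → List B) {C : ℕ}
    (hF : ∀ a, (F a).length ≤ C) {s : List B} (hs : 2 * C < s.length) {l : List A}
    (h : s <:+: l.flatMap F) : ∃ a ∈ l, F a <:+: s := by
  induction l with
  | nil =>
    have := h.length_le
    rw [List.flatMap_nil, List.length_nil] at this
    omega
  | cons a l ih =>
    obtain ⟨p, q, hpq⟩ := h
    rw [List.flatMap_cons, List.append_assoc] at hpq
    rcases List.append_eq_append_iff.1 hpq with ⟨r, hr, hs'⟩ | ⟨r, hr, hs'⟩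
    · have hra : r.length ≤ C := by
        have h1 := hF a
        rw [hr, List.length_append] at h1
        omega
      obtain ⟨s₂, rfl⟩ : r <+: s :=
        List.prefix_of_prefix_length_le ⟨l.flatMap F, rfl⟩ ⟨q, hs'⟩ (by omega)
      rw [List.append_assoc, List.append_cancel_left_eq] at hs'
      obtain ⟨b, hb, hb'⟩ := exists_prefix_of_prefix_flatMap F hF (s := s₂) (l := l)
        (by rw [List.length_append] at hs; omega) ⟨q, hs'⟩
      exact ⟨b, by simp [hb], hb'.isInfix.trans (List.suffix_append _ _).isInfix⟩
    · obtain ⟨b, hb, hb'⟩ := ih ⟨r, q, by rw [hs', List.append_assoc]⟩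
      exact ⟨b, by simp [hb], hb'⟩

/-! ### Oriented edges and paths -/

theorem CellGraph.t_eq_o_inv (Γ : CellGraph V E) (e : OEdge E) : Γ.t e = Γ.o e.inv := by
  rcases e with ⟨e, _ | _⟩ <;> rfl

theorem invRev_singleton (e : OEdge E) : FreeGroup.invRev [e] = [e.inv] := rfl

theorem mk_cons (e : OEdge E) (l : List (OEdge E)) :
    FreeGroup.mk (e :: l) = FreeGroup.mk [e] * FreeGroup.mk l := by
  rw [FreeGroup.mul_mk, List.singleton_append]

namespace CellMap

variable {Γ : CellGraph V E} {Γ' : CellGraph V' E'} {Γ'' : CellGraph V'' E''}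

theorem oedge_inv (f : CellMap Γ Γ') (e : OEdge E) :
    f.oedge e.inv = FreeGroup.invRev (f.oedge e) := by
  rcases e with ⟨e, _ | _⟩ <;> simp [oedge, OEdge.inv]

@[simp] theorem path_nil (f : CellMap Γ Γ') : f.path [] = [] := rfl

theorem path_cons (f : CellMap Γ Γ') (e : OEdge E) (l : List (OEdge E)) :
    f.path (e :: l) = f.oedge e ++ f.path l := List.flatMap_cons

theorem path_append (f : CellMap Γ Γ') (l l' : List (OEdge E)) :
    f.path (l ++ l') = f.path l ++ f.path l' := List.flatMap_append

theorem path_invRev (f : CellMap Γ Γ') (l : List (OEdge E)) :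
    f.path (FreeGroup.invRev l) = FreeGroup.invRev (f.path l) := by
  induction l with
  | nil => rfl
  | cons e l ih =>
    rw [FreeGroup.invRev_cons, path_append, ih, path_cons, FreeGroup.invRev_append,
      invRev_singleton, path_cons, oedge_inv]
    simp

theorem mk_path (f : CellMap Γ Γ') (l : List (OEdge E)) :
    FreeGroup.mk (f.path l) = f.hom (FreeGroup.mk l) := by
  induction l with
  | nil => exact (map_one f.hom).symm
  | cons e l ih =>
    rw [path_cons, ← FreeGroup.mul_mk, ih, mk_cons, map_mul]
    congr 1
    rcases e with ⟨e, _ | _⟩ <;> simp [hom, oedge, FreeGroup.inv_mk]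

theorem path_iterate_append (f : CellMap Γ Γ) (n : ℕ) (l l' : List (OEdge E)) :
    f.path^[n] (l ++ l') = f.path^[n] l ++ f.path^[n] l' := by
  induction n generalizing l l' with
  | zero => rfl
  | succ n ih => simp only [Function.iterate_succ_apply, path_append, ih]

theorem path_iterate_invRev (f : CellMap Γ Γ) (n : ℕ) (l : List (OEdge E)) :
    f.path^[n] (FreeGroup.invRev l) = FreeGroup.invRev (f.path^[n] l) := by
  induction n generalizing l with
  | zero => rfl
  | succ n ih => simp only [Function.iterate_succ_apply, path_invRev, ih]

theorem path_iterate_eq_flatMap (f : CellMap Γ Γ) (n : ℕ) (l : List (OEdge E)) :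
    f.path^[n] l = l.flatMap (f.iter n) := by
  induction l with
  | nil => exact Function.iterate_fixed f.path_nil n
  | cons e l ih => rw [List.flatMap_cons, ← ih, iter, ← path_iterate_append, List.singleton_append]

theorem iter_inv (f : CellMap Γ Γ) (n : ℕ) (e : OEdge E) :
    f.iter n e.inv = FreeGroup.invRev (f.iter n e) := by
  rw [iter, iter, ← path_iterate_invRev, invRev_singleton]

theorem iter_add (f : CellMap Γ Γ) (m n : ℕ) (e : OEdge E) :
    f.iter (m + n) e = f.path^[m] (f.iter n e) := Function.iterate_add_apply _ _ _ _

theorem path_iterate_infix (f : CellMap Γ Γ) (n : ℕ) {l l' : List (OEdge E)} (h : l <:+: l') :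
    f.path^[n] l <:+: f.path^[n] l' := by
  obtain ⟨p, q, rfl⟩ := h
  rw [path_iterate_append, path_iterate_append]
  exact List.infix_append _ _ _

theorem iter_infix_iter_add (f : CellMap Γ Γ) {m n : ℕ} {a b : OEdge E} (h : a ∈ f.iter n b) :
    f.iter m a <:+: f.iter (m + n) b := by
  rw [iter_add]
  obtain ⟨p, q, h⟩ := List.append_of_mem h
  exact f.path_iterate_infix m ⟨p, q, by simp [h]⟩

theorem path_iterate_isPath (f : CellMap Γ Γ) (n : ℕ) {l : List (OEdge E)} {u v : V}
    (h : Γ.IsPath u v l) : Γ.IsPath (f.vert^[n] u) (f.vert^[n] v) (f.path^[n] l) := by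
  induction n generalizing l u v with
  | zero => exact h
  | succ n ih => exact ih (f.path_isPath h)

theorem isPath_singleton (Γ : CellGraph V E) (e : OEdge E) : Γ.IsPath (Γ.o e) (Γ.t e) [e] :=
  ⟨rfl, rfl⟩

/-! ### Positive transition matrices -/

theorem mem_invRev_iff {e : OEdge E} {l : List (OEdge E)} :
    e ∈ FreeGroup.invRev l ↔ e.inv ∈ l := by
  rcases e with ⟨e, b⟩
  simp [FreeGroup.invRev, OEdge.inv]

theorem mem_iter_inv {f : CellMap Γ Γ} {n : ℕ} {a b : OEdge E} :
    a ∈ f.iter n b.inv ↔ a.inv ∈ f.iter n b := by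
  rw [iter_inv, mem_invRev_iff]

/-- Powers of a positive matrix are positive. The matrix ignores orientation, hence the alternative
between `b` and its inverse. -/
theorem mem_iter_succ_or (f : CellMap Γ Γ) (hA : ∀ i j : E, 0 < f.transitionMatrix i j)
    (n : ℕ) (a b : OEdge E) : a ∈ f.iter (n + 1) b ∨ a ∈ f.iter (n + 1) b.inv := by
  have key : ∀ a b : OEdge E, a ∈ f.oedge b ∨ a.inv ∈ f.oedge b := by
    rintro ⟨a, s⟩ ⟨b, s'⟩
    classical
    have h := hA a b
    rw [transitionMatrix, List.count_pos_iff, List.mem_map] at h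
    obtain ⟨⟨a', s''⟩, h, rfl⟩ := h
    cases s' <;> cases s <;> cases s'' <;> simp_all [oedge, mem_invRev_iff, OEdge.inv]
  have one : ∀ b, f.iter 1 b = f.oedge b := fun b => by simp [iter, path_cons]
  rw [mem_iter_inv]
  induction n generalizing a with
  | zero => simpa [one] using key a b
  | succ n ih =>
    have step : ∀ c : OEdge E, c ∈ f.iter (n + 1) b →
        a ∈ f.iter (n + 1 + 1) b ∨ a.inv ∈ f.iter (n + 1 + 1) b := by
      intro c hc
      have := f.iter_infix_iter_add (m := 1) hc
      rw [one, add_comm] at this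
      exact (key a c).imp (fun h => this.subset h) (fun h => this.subset h)
    rcases ih a with h | h
    exacts [step _ h, step _ h]

theorem iter_ne_nil (f : CellMap Γ Γ) (hf : f.IsGraphMap) (n : ℕ) (e : OEdge E) :
    f.iter n e ≠ [] := by
  have h1 : ∀ l : List (OEdge E), l ≠ [] → f.path l ≠ [] := by
    rintro (_ | ⟨⟨e, s⟩, l⟩) h
    · exact absurd rfl h
    · rw [path_cons]
      refine List.append_ne_nil_of_left_ne_nil (fun h => (hf e).1 ?_) _
      cases s
      · simpa [oedge, FreeGroup.invRev] using h
      · simpa [oedge] using h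
  rw [iter]
  induction n with
  | zero => simp
  | succ n ih =>
    rw [Function.iterate_succ_apply']
    exact h1 _ ih

/-! ### Homotopy equivalences act surjectively on loops -/

/-- Squares over consecutive edges share a side, so they glue to a rectangle over the whole path. -/
theorem Homotopic.mk_path {f g : CellMap Γ Γ'} {p : V → List (OEdge E')}
    (hp : ∀ e : E, FreeGroup.mk (f.edge e ++ p (Γ.tgt e)) =
      FreeGroup.mk (p (Γ.src e) ++ g.edge e)) {l : List (OEdge E)} {u v : V}
    (hl : Γ.IsPath u v l) :
    FreeGroup.mk (f.path l) * FreeGroup.mk (p v) =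
      FreeGroup.mk (p u) * FreeGroup.mk (g.path l) := by
  induction l generalizing u with
  | nil =>
    cases hl
    rw [path_nil, path_nil, ← FreeGroup.one_eq_mk, one_mul, mul_one]
  | cons e l ih =>
    obtain ⟨rfl, hl⟩ := hl
    have h : FreeGroup.mk (f.oedge e) * FreeGroup.mk (p (Γ.t e)) =
        FreeGroup.mk (p (Γ.o e)) * FreeGroup.mk (g.oedge e) := by
      rcases e with ⟨e, s⟩
      have h := hp e
      simp only [← FreeGroup.mul_mk] at h
      cases s
      · simp only [oedge, o, t, Bool.false_eq_true, if_false, ← FreeGroup.inv_mk]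
        rw [inv_mul_eq_iff_eq_mul, ← mul_assoc, h, mul_inv_cancel_right]
      · simpa [oedge, o, t] using h
    rw [path_cons, path_cons, ← FreeGroup.mul_mk, ← FreeGroup.mul_mk, mul_assoc, ih hl,
      ← mul_assoc, h, mul_assoc]

theorem path_comp (g : CellMap Γ' Γ'') (f : CellMap Γ Γ') (l : List (OEdge E)) :
    (g.comp f).path l = g.path (f.path l) := by
  induction l with
  | nil => rfl
  | cons e l ih =>
    rw [path_cons, path_cons, path_append, ih]
    congr 1
    rcases e with ⟨e, _ | _⟩
    · simp [oedge, comp, path_invRev]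
    · simp [oedge, comp]

theorem path_id (l : List (OEdge E)) : (CellMap.id Γ).path l = l := by
  induction l with
  | nil => rfl
  | cons e l ih =>
    rw [path_cons, ih]
    rcases e with ⟨e, _ | _⟩ <;> rfl

theorem IsHomotopyEquiv.exists_loop {f : CellMap Γ Γ'} (hf : f.IsHomotopyEquiv) (v : V)
    {k : List (OEdge E')} (hk : Γ'.IsPath (f.vert v) (f.vert v) k) :
    ∃ l, Γ.IsPath v v l ∧ FreeGroup.mk (f.path l) = FreeGroup.mk k := by
  obtain ⟨g, ⟨p, hp, -⟩, q, hq, hq'⟩ := hf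
  have hpv : Γ.IsPath (g.vert (f.vert v)) v (p v) := hp v
  have hqv : Γ'.IsPath (f.vert (g.vert (f.vert v))) (f.vert v) (q (f.vert v)) := hq (f.vert v)
  -- The tracks p and q of the two homotopies need not be compatible: their discrepancy is a loop m
  -- = f(p)⁻¹ q. Applying f to p⁻¹ g(k') p gives m k' m⁻¹ up to homotopy, so k' = m⁻¹ k m is the
  -- right input.
  have hm : Γ'.IsPath (f.vert v) (f.vert v)
      (FreeGroup.invRev (f.path (p v)) ++ q (f.vert v)) :=
    (f.path_isPath hpv).invRev.append hqv
  have hk' := (hm.invRev.append hk).append hm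
  refine ⟨_, (hpv.invRev.append (g.path_isPath hk')).append hpv, ?_⟩
  have h := Homotopic.mk_path hq' hk'
  rw [path_comp, path_id, ← eq_mul_inv_iff_mul_eq] at h
  simp only [path_append, path_invRev, ← FreeGroup.mul_mk, ← FreeGroup.inv_mk] at h ⊢
  rw [h]
  group

theorem IsHomotopyEquiv.exists_loop_iterate {f : CellMap Γ Γ} (hf : f.IsHomotopyEquiv) (n : ℕ)
    (v : V) {k : List (OEdge E)} (hk : Γ.IsPath (f.vert^[n] v) (f.vert^[n] v) k) :
    ∃ l, Γ.IsPath v v l ∧ FreeGroup.mk (f.path^[n] l) = FreeGroup.mk k := by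
  have hhom : ∀ (n : ℕ) (l : List (OEdge E)),
      FreeGroup.mk (f.path^[n] l) = f.hom^[n] (FreeGroup.mk l) := by
    intro n
    induction n with
    | zero => exact fun _ => rfl
    | succ n ih =>
      intro l
      rw [Function.iterate_succ_apply, ih, mk_path, Function.iterate_succ_apply]
  induction n generalizing v k with
  | zero => exact ⟨k, hk, rfl⟩
  | succ n ih =>
    obtain ⟨l₁, hl₁, h₁⟩ := ih (f.vert v) hk
    obtain ⟨l, hl, h⟩ := hf.exists_loop v hl₁
    exact ⟨l, hl, by rw [Function.iterate_succ_apply, hhom, h, ← hhom, h₁]⟩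

theorem IsHomotopyInverse.hom_injective {N : ℕ} {α : CellMap (rose N) Γ}
    {β : CellMap Γ (rose N)} (h : α.IsHomotopyInverse β) : Function.Injective α.hom := by
  obtain ⟨⟨p, -, hp⟩, -⟩ := h
  rw [injective_iff_map_eq_one]
  intro w hw
  have hpath : ∀ l : List (OEdge (Fin N)), (rose N).IsPath () () l := by
    intro l
    induction l with
    | nil => rfl
    | cons e l ih => exact ⟨rfl, ih⟩
  have h := Homotopic.mk_path hp (hpath w.toWord)
  rw [path_comp, path_id, CellMap.mk_path, CellMap.mk_path, FreeGroup.mk_toWord, hw, map_one,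
    one_mul] at h
  exact mul_left_cancel (h.symm.trans (mul_one _).symm)

end CellMap

/-! ### Lifting words to a set of edges of a covering

A covering with monodromy on a `FreeGroup E`-set `Q` has the set of edges `E × Q`, where `(e, c)`
starts at the sheet `c` and ends at the sheet `(of e)⁻¹ • c`. -/

section Lifts

open scoped Pointwise

variable {Q : Type*} [MulAction (FreeGroup E) Q] (D : Set (E × Q))

/-- The lift of the oriented edge `e` that starts at `c` belongs to `D`. -/
def LiftMem (e : OEdge E) (c : Q) : Prop :=
  if e.2 then (e.1, c) ∈ D else (e.1, FreeGroup.of e.1 • c) ∈ D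

/-- The starting points of lifts of the word `l` that are contained in `D`. -/
def lifts : List (OEdge E) → Set Q
  | [] => Set.univ
  | e :: l => {c | LiftMem D e c ∧ (FreeGroup.mk [e])⁻¹ • c ∈ lifts l}

variable {D}

theorem liftMem_inv (e : OEdge E) (c : Q) :
    LiftMem D e.inv c ↔ LiftMem D e (FreeGroup.mk [e] • c) := by
  rcases e with ⟨e, _ | _⟩
  · have : (FreeGroup.mk [(e, false)] : FreeGroup E) = (FreeGroup.of e)⁻¹ := rfl
    simp [LiftMem, OEdge.inv, this]
  · have : (FreeGroup.mk [(e, true)] : FreeGroup E) = FreeGroup.of e := rfl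
    simp [LiftMem, OEdge.inv, this]

theorem mem_lifts_append {l l' : List (OEdge E)} {c : Q} :
    c ∈ lifts D (l ++ l') ↔ c ∈ lifts D l ∧ (FreeGroup.mk l)⁻¹ • c ∈ lifts D l' := by
  induction l generalizing c with
  | nil => simp [lifts, ← FreeGroup.one_eq_mk]
  | cons e l ih =>
    simp only [List.cons_append, lifts, Set.mem_ofPred_eq, ih, smul_smul, mk_cons e l, mul_inv_rev,
      and_assoc]

theorem mem_lifts_invRev {l : List (OEdge E)} {c : Q} :
    c ∈ lifts D (FreeGroup.invRev l) ↔ FreeGroup.mk l • c ∈ lifts D l := by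
  induction l generalizing c with
  | nil => simp [lifts]
  | cons e l ih =>
    rw [FreeGroup.invRev_cons, mem_lifts_append, ih, invRev_singleton, ← FreeGroup.inv_mk, inv_inv]
    simp only [lifts, Set.mem_ofPred_eq, Set.mem_univ, and_true, liftMem_inv, smul_smul,
      mk_cons e l, inv_mul_cancel_left]
    exact and_comm

theorem lifts_append_append_subset (p l q : List (OEdge E)) :
    lifts D (p ++ l ++ q) ⊆ FreeGroup.mk p • lifts D l := by
  intro c hc
  rw [mem_lifts_append, mem_lifts_append] at hc
  exact Set.mem_smul_set_iff_inv_smul_mem.2 hc.1.2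

/-- The first edge of a lift lies in D and determines the starting sheet. The empty word lifts from
every sheet and must be excluded. -/
theorem lifts_finite (hD : D.Finite) {l : List (OEdge E)} (hl : l ≠ []) :
    (lifts D l).Finite := by
  rcases l with _ | ⟨⟨e, _ | _⟩, l⟩
  · exact absurd rfl hl
  · refine ((hD.image Prod.snd).image fun c => (FreeGroup.of e)⁻¹ • c).subset ?_
    intro c hc
    exact ⟨_, ⟨_, hc.1, rfl⟩, inv_smul_smul _ _⟩
  · refine (hD.image Prod.snd).subset ?_
    intro c hc
    exact ⟨_, hc.1, rfl⟩

/-- Moving along the prefix p sends lifts of the long word injectively to lifts of the subword. The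
latter must be finite, since `ncard` is 0 on infinite sets. -/
theorem ncard_lifts_le_of_infix (hD : D.Finite) {l l' : List (OEdge E)} (hl : l ≠ [])
    (h : l <:+: l') : (lifts D l').ncard ≤ (lifts D l).ncard := by
  obtain ⟨p, q, rfl⟩ := h
  have := Set.ncard_le_ncard (lifts_append_append_subset (D := D) p l q)
    ((lifts_finite hD hl).smul_set)
  rwa [Set.ncard_smul_set] at this

theorem lifts_nonempty_of_infix {l l' : List (OEdge E)} (h : l <:+: l')
    (h' : (lifts D l').Nonempty) : (lifts D l).Nonempty := by
  obtain ⟨p, q, rfl⟩ := h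
  exact Set.smul_set_nonempty.1 (h'.mono (lifts_append_append_subset p l q))

theorem lifts_invRev (l : List (OEdge E)) :
    lifts D (FreeGroup.invRev l) = (FreeGroup.mk l)⁻¹ • lifts D l := by
  ext c
  rw [mem_lifts_invRev, Set.mem_smul_set_iff_inv_smul_mem, inv_inv]

theorem ncard_lifts_invRev (l : List (OEdge E)) :
    (lifts D (FreeGroup.invRev l)).ncard = (lifts D l).ncard := by
  rw [lifts_invRev, Set.ncard_smul_set]

/-- Recording a lift of p⁻¹ q by its sheet at the turn rather than at its start identifies such
lifts with the sheets from which both p and q lift. -/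
theorem lifts_turn_infix {l p q : List (OEdge E)} (h : FreeGroup.invRev p ++ q <:+: l)
    (hD : D.Finite) (hp : p ≠ []) :
    (lifts D l).ncard ≤ (lifts D p ∩ lifts D q).ncard := by
  obtain ⟨a, b, rfl⟩ := h
  have h1 := lifts_append_append_subset (D := D) a (FreeGroup.invRev p ++ q) b
  have h2 : lifts D (FreeGroup.invRev p ++ q) =
      (FreeGroup.mk p)⁻¹ • (lifts D p ∩ lifts D q) := by
    ext c
    rw [mem_lifts_append, mem_lifts_invRev, Set.mem_smul_set_iff_inv_smul_mem, inv_inv,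
      ← FreeGroup.inv_mk, inv_inv]
    rfl
  rw [h2, smul_smul] at h1
  have := Set.ncard_le_ncard h1 (((lifts_finite hD hp).inter_of_left _).smul_set)
  rwa [Set.ncard_smul_set] at this

/-! ### Lifts of iterated edges: stabilization and invariance. -/

variable {Γ : CellGraph V E} {f : CellMap Γ Γ}

theorem ncard_lifts_iter_succ_le (hf : f.IsGraphMap) (hA : ∀ i j : E, 0 < f.transitionMatrix i j)
    (hD : D.Finite) (n k : ℕ) (a b : OEdge E) :
    (lifts D (f.iter (n + (k + 1)) a)).ncard ≤ (lifts D (f.iter n b)).ncard := by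
  have h : ∀ a, b ∈ f.iter (k + 1) a →
      (lifts D (f.iter (n + (k + 1)) a)).ncard ≤ (lifts D (f.iter n b)).ncard := fun a h =>
    ncard_lifts_le_of_infix hD (f.iter_ne_nil hf n b) (f.iter_infix_iter_add h)
  rcases f.mem_iter_succ_or hA k b a with h' | h'
  · exact h a h'
  · have := h _ h'
    rwa [CellMap.iter_inv, ncard_lifts_invRev] at this

/-- The number of lifts of `fⁿ(e)` to `D` is eventually independent of `n` and of `e`. -/
theorem exists_ncard_lifts_iter_eq (hf : f.IsGraphMap)
    (hA : ∀ i j : E, 0 < f.transitionMatrix i j) (hD : D.Finite) (e₀ : OEdge E) :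
    ∃ n c, ∀ k (e : OEdge E), (lifts D (f.iter (n + k) e)).ncard = c := by
  have hle := ncard_lifts_iter_succ_le (D := D) hf hA hD
  have hanti : Antitone fun n => (lifts D (f.iter n e₀)).ncard :=
    antitone_nat_of_succ_le fun n => hle n 0 e₀ e₀
  obtain ⟨n, hn⟩ := WellFoundedLT.antitone_chain_condition hanti
  -- With the `e₀` counts constant from level n on, the count of any e at level n + 1 + k is
  -- squeezed between those of `e₀` at levels n + 1 + k + 1 and n. Each comparison costs one level,
  -- hence the start at n + 1.
  refine ⟨n + 1, _, fun k e => le_antisymm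
    ((hle n k e e₀).trans' (by rw [show n + 1 + k = n + (k + 1) by omega])) ?_⟩
  rw [hn (n + 1 + k + 1) (by omega)]
  exact hle (n + 1 + k) 0 e₀ e

/-- If the Whitehead graphs are connected and the number of lifts of `fⁿ(e)` is stable, then the
starting points of these lifts depend only on the initial vertex of `e`. -/
theorem lifts_iter_eq_of_o_eq (hf : f.IsGraphMap)
    (hW : ∀ v : V, (whiteheadGraph f v).Connected) (hD : D.Finite) {n c : ℕ}
    (hc : ∀ k (e : OEdge E), (lifts D (f.iter (n + k) e)).ncard = c) {e e' : OEdge E}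
    (h : Γ.o e = Γ.o e') : lifts D (f.iter n e) = lifts D (f.iter n e') := by
  have hc0 : ∀ e, (lifts D (f.iter n e)).ncard = c := hc 0
  have turn : ∀ (a b x : OEdge E) (k : ℕ), [a.inv, b] <:+: f.iter k x →
      lifts D (f.iter n a) = lifts D (f.iter n b) := by
    intro a b x k hk
    -- Applying f^n to the turn places f^n(a)⁻¹ f^n(b) inside f^(n+k)(x), which has c lifts. The
    -- intersection of two c-element sets then has at least c elements, so it equals both.
    have h1 := f.path_iterate_infix n hk
    rw [← CellMap.iter_add, CellMap.path_iterate_eq_flatMap] at h1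
    simp only [List.flatMap_cons, List.flatMap_nil, List.append_nil, CellMap.iter_inv] at h1
    have h2 := lifts_turn_infix h1 hD (f.iter_ne_nil hf n a)
    rw [hc] at h2
    have ha := Set.eq_of_subset_of_ncard_le Set.inter_subset_left ((hc0 a).trans_le h2)
      (lifts_finite hD (f.iter_ne_nil hf n a))
    have hb := Set.eq_of_subset_of_ncard_le Set.inter_subset_right ((hc0 b).trans_le h2)
      (lifts_finite hD (f.iter_ne_nil hf n b))
    exact ha.symm.trans hb
  have adj : ∀ {v : V} (a b : {e : OEdge E // Γ.o e = v}), (whiteheadGraph f v).Reachable a b →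
      lifts D (f.iter n a.1) = lifts D (f.iter n b.1) := by
    rintro v a b ⟨w⟩
    induction w with
    | nil => rfl
    | cons hab _ ih =>
      obtain ⟨-, -, k, -, x, hx | hx⟩ := hab
      · exact (turn _ _ x k hx).trans ih
      · exact (turn _ _ x k hx).symm.trans ih
  exact adj ⟨e, h⟩ ⟨e', rfl⟩ ((hW _).preconnected _ _)

theorem inv_smul_mem_lifts_of_isPath {n : ℕ}
    (hS : ∀ {e e' : OEdge E}, Γ.o e = Γ.o e' → lifts D (f.iter n e) = lifts D (f.iter n e'))
    {l : List (OEdge E)} {u v : V} (hl : Γ.IsPath u v l) {e e' : OEdge E} (he : Γ.o e = u)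
    (he' : Γ.o e' = v) {c : Q} (h : c ∈ lifts D (f.iter n e)) :
    (FreeGroup.mk (f.path^[n] l))⁻¹ • c ∈ lifts D (f.iter n e') := by
  induction l generalizing u e c with
  | nil =>
    cases hl
    rw [Function.iterate_fixed f.path_nil n, ← FreeGroup.one_eq_mk, inv_one, one_smul]
    rwa [hS (he'.trans he.symm)]
  | cons a l ih =>
    obtain ⟨rfl, hl⟩ := hl
    rw [hS he] at h
    -- Traversed backwards, the lift of f^n(a) is a lift of f^n(a⁻¹), and a⁻¹ issues from the vertex
    -- where the remaining path starts.
    have h' : (FreeGroup.mk (f.iter n a))⁻¹ • c ∈ lifts D (f.iter n a.inv) := by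
      rwa [CellMap.iter_inv, mem_lifts_invRev, smul_inv_smul]
    have := ih hl (Γ.t_eq_o_inv a).symm h'
    rwa [smul_smul, ← mul_inv_rev, FreeGroup.mul_mk, CellMap.iter.eq_1 f n a,
      ← CellMap.path_iterate_append, List.singleton_append] at this

end Lifts

/-! ### Segments of leaves. -/

theorem segment_eq_map (γ : ℤ → OEdge E) (i j : ℤ) :
    segment γ i j = (List.range (j - i + 1).toNat).map fun k : ℕ => γ (i + (k : ℤ)) := by
  -- In `segment` the list of naturals itself is coerced to a list of integers, through the list
  -- monad; the cast is moved into the mapped function.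
  rw [segment, List.bind_eq_flatMap, List.map_flatMap, List.map_eq_flatMap]
  rfl

/-- A leaf of the stable lamination contains some `fⁿ(e)`, for every `n`. -/
theorem exists_iter_infix_segment {Γ : CellGraph V E} [Finite E] {f : CellMap Γ Γ}
    (hA : ∀ i j : E, 0 < f.transitionMatrix i j) {γ : ℤ → OEdge E}
    (hγ : γ ∈ stableLamination f) (n : ℕ) :
    ∃ (e : OEdge E) (j : ℤ), f.iter n e <:+: segment γ 0 j := by
  obtain ⟨C, hC⟩ := (Set.finite_range fun e => (f.iter n e).length).bddAbove
  have hC' : ∀ e, (f.iter n e).length ≤ C := fun e => hC ⟨e, rfl⟩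
  obtain ⟨m, -, a, ha⟩ := hγ.2 0 (2 * C) (by positivity)
  -- The exponent m may be smaller than n. Placing a inside f^(n+1)(b) raises it, so that the
  -- segment lies in f^n(f^(m+1)(b)), a concatenation of blocks f^n(e).
  obtain ⟨b, hb⟩ : ∃ b, a ∈ f.iter (n + 1) b := by
    rcases f.mem_iter_succ_or hA n a a with h | h
    exacts [⟨_, h⟩, ⟨_, h⟩]
  have h := ha.trans (f.iter_infix_iter_add (m := m) hb)
  rw [show m + (n + 1) = n + (m + 1) by omega, CellMap.iter_add,
    CellMap.path_iterate_eq_flatMap] at h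
  have hlen : 2 * C < (segment γ 0 (2 * C)).length := by
    simp only [segment_eq_map, List.length_map, List.length_range]
    omega
  obtain ⟨e, -, he⟩ := exists_infix_of_infix_flatMap _ hC' hlen h
  exact ⟨e, _, he⟩

/-! ### The covering of a subgroup -/

section Cover

variable {N : ℕ} {Γ : CellGraph V E} {α : CellMap (rose N) Γ} {H : Subgroup (FreeGroup (Fin N))}

/-- The position of an edge of the covering: the edge below it and the sheet of its origin. -/
def coverPosition (y : CoverEdge α H) : E × (FreeGroup E ⧸ markedSubgroup α H) :=
  (y.1.2, y.1.1.1.2)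

theorem liftMem_coverProj {S : Set (CoverEdge α H)} {y : OEdge (CoverEdge α H)} (hy : y.1 ∈ S) :
    LiftMem (coverPosition '' S) (coverProj α H y) ((cover α H).o y).1.2 := by
  rcases y with ⟨y, _ | _⟩
  · refine ⟨y, hy, ?_⟩
    simp [coverPosition, coverProj, o, cover]
  · exact ⟨y, hy, rfl⟩

theorem cover_t (y : OEdge (CoverEdge α H)) :
    ((cover α H).t y).1.2 = (FreeGroup.mk [coverProj α H y])⁻¹ • ((cover α H).o y).1.2 := by
  rcases y with ⟨y, _ | _⟩
  · have : (FreeGroup.mk [(y.1.2, false)] : FreeGroup E) = (FreeGroup.of y.1.2)⁻¹ := rfl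
    simp [coverProj, o, t, cover, this]
  · rfl

theorem mem_lifts_segment {S : Set (CoverEdge α H)} {γ' : ℤ → OEdge (CoverEdge α H)}
    (hγ' : IsBiinfinitePath (cover α H) γ') (hS : ∀ i, (γ' i).1 ∈ S) (i j : ℤ) :
    ((cover α H).o (γ' i)).1.2 ∈
      lifts (coverPosition '' S) (segment (fun k => coverProj α H (γ' k)) i j) := by
  rw [segment_eq_map]
  generalize (j - i + 1).toNat = m
  induction m generalizing i with
  | zero => trivial
  | succ m ih =>
    rw [List.range_succ_eq_map, List.map_cons, List.map_map]
    refine ⟨by simpa using liftMem_coverProj (hS i), ?_⟩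
    have h := ih (i + 1)
    rw [← hγ' i, cover_t] at h
    simp only [Nat.cast_zero, add_zero]
    convert h using 2
    apply List.map_congr_left
    intro k _
    simp only [Function.comp_apply, Nat.cast_succ, add_assoc, add_comm (1 : ℤ)]

/-- The sheets in which a nontrivial word lifts are sheets of the covering. -/
theorem exists_isPath_of_mem_lifts {S : Set (CoverEdge α H)} {l : List (OEdge E)} (hl : l ≠ [])
    {u v : V} (hp : Γ.IsPath u v l) {c : FreeGroup E ⧸ markedSubgroup α H}
    (hc : c ∈ lifts (coverPosition '' S) l) :
    ∃ l₀ : List (OEdge E), Γ.IsPath (α.vert ()) u l₀ ∧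
      c = (((FreeGroup.mk l₀)⁻¹ : FreeGroup E) : FreeGroup E ⧸ markedSubgroup α H) := by
  rcases l with _ | ⟨⟨e, _ | _⟩, l⟩
  · exact absurd rfl hl
  · obtain ⟨rfl, -⟩ := hp
    obtain ⟨⟨y, -, hy⟩, -⟩ := hc
    obtain ⟨⟨⟨⟨v', c'⟩, l₀, hl₀, hc'⟩, e'⟩, he'⟩ := y
    obtain ⟨rfl, hy⟩ := Prod.ext_iff.1 hy
    dsimp only at hl₀ hc' he'
    subst he'
    change c' = _ at hy
    refine ⟨l₀ ++ [(e', true)], hl₀.append ⟨rfl, rfl⟩, ?_⟩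
    rw [← FreeGroup.mul_mk, mul_inv_rev]
    change c = (FreeGroup.of e')⁻¹ •
      (((FreeGroup.mk l₀)⁻¹ : FreeGroup E) : FreeGroup E ⧸ markedSubgroup α H)
    rw [← hc']
    exact eq_inv_smul_iff.2 hy.symm
  · obtain ⟨rfl, -⟩ := hp
    obtain ⟨⟨y, -, hy⟩, -⟩ := hc
    obtain ⟨⟨⟨⟨v', c'⟩, l₀, hl₀, hc'⟩, e'⟩, he'⟩ := y
    obtain ⟨rfl, hy⟩ := Prod.ext_iff.1 hy
    dsimp only at hl₀ hc' he'
    subst he'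
    change c' = _ at hy
    exact ⟨l₀, hl₀, hy.symm.trans hc'⟩

/-- If a finite set of sheets is invariant under all loops based at a vertex, then the subgroup
has finite index. -/
theorem index_ne_zero_of_loops (hα : Function.Injective α.hom) {u : V} {l₀ : List (OEdge E)}
    (hl₀ : Γ.IsPath (α.vert ()) u l₀) {T : Set (FreeGroup E ⧸ markedSubgroup α H)}
    (hT : T.Finite)
    (h : ∀ k, Γ.IsPath u u k → (FreeGroup.mk k)⁻¹ •
      (((FreeGroup.mk l₀)⁻¹ : FreeGroup E) : FreeGroup E ⧸ markedSubgroup α H) ∈ T) :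
    H.index ≠ 0 := by
  have hmem : ∀ w : FreeGroup (Fin N), (FreeGroup.mk l₀)⁻¹ •
      ((α.hom w : FreeGroup E) : FreeGroup E ⧸ markedSubgroup α H) ∈ T := by
    intro w
    have hpath : ∀ l : List (OEdge (Fin N)), (rose N).IsPath () () l := by
      intro l
      induction l with
      | nil => rfl
      | cons e l ih => exact ⟨rfl, ih⟩
    -- The loop l₀⁻¹ α(w⁻¹) l₀ at u moves the sheet of l₀⁻¹ to that of l₀⁻¹ α(w). As w varies, the
    -- cosets of H thus embed in T, by injectivity of `α.hom`.
    have h' := h _ ((hl₀.invRev.append (α.path_isPath (hpath (w⁻¹).toWord))).append hl₀)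
    rw [← FreeGroup.mul_mk, ← FreeGroup.mul_mk, CellMap.mk_path, FreeGroup.mk_toWord, map_inv,
      ← FreeGroup.inv_mk] at h'
    convert h' using 1
    change (((FreeGroup.mk l₀)⁻¹ * α.hom w : FreeGroup E) :
      FreeGroup E ⧸ markedSubgroup α H) = ((_ * _ : FreeGroup E) : _)
    congr 1
    group
  have hfin : Finite (FreeGroup (Fin N) ⧸ H) := by
    have := hT.to_subtype
    have hinj : ∀ w w' : FreeGroup (Fin N),
        ((α.hom w : FreeGroup E) : FreeGroup E ⧸ markedSubgroup α H) = (α.hom w' : FreeGroup E) →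
        (w : FreeGroup (Fin N) ⧸ H) = w' := by
      intro w w' hw
      rw [QuotientGroup.eq, ← map_inv, ← map_mul] at hw
      obtain ⟨x, hx, hx'⟩ := hw
      rw [QuotientGroup.eq, ← hα hx']
      exact hx
    refine Finite.of_injective
      (fun x : FreeGroup (Fin N) ⧸ H => (⟨_, hmem x.out⟩ : T)) fun x y hxy => ?_
    have := hinj _ _ (smul_left_cancel _ (Subtype.ext_iff.1 hxy))
    simpa using this
  exact Subgroup.index_ne_zero_of_finite

end Cover

end TrainTrack

theorem proposition4p2 {V E : Type*} (N : ℕ) (hN : 2 ≤ N)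
    (φ : TrainTrack.Out (FreeGroup (Fin N)))
    (Γ : TrainTrack.CellGraph V E)
    (α : TrainTrack.CellMap (TrainTrack.rose N) Γ)
    (f : TrainTrack.CellMap Γ Γ)
    (hf : TrainTrack.IsTrainTrackRepresentative φ α f)
    (hA : ∀ i j : E, 0 < f.transitionMatrix i j)
    (hW : ∀ v : V, (TrainTrack.whiteheadGraph f v).Connected) :
    ¬ ∃ H : Subgroup (FreeGroup (Fin N)),
      H.FG ∧ H.index = 0 ∧ TrainTrack.CarriesLeaf α f H := by
  open TrainTrack in
  rintro ⟨H, -, hH, -, -, Δ, hΔ, γ, hγ, γ', hγ', hγγ'⟩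
  have := hf.finite_edge
  have hg := hf.graphMap
  obtain ⟨β, hβ, -⟩ := hf.marking
  have hD : (coverPosition '' Δ.edges).Finite := hΔ.1.2.1.image _
  -- Any edge of Γ would do as reference; `γ 0` shows that there is one.
  obtain ⟨n, c, hc⟩ := exists_ncard_lifts_iter_eq hg hA hD (γ 0)
  obtain ⟨e, j, he⟩ := exists_iter_infix_segment hA hγ n
  have hseg := mem_lifts_segment hγ' (fun i => (hγγ' i).1) 0 j
  rw [funext fun i => (hγγ' i).2] at hseg
  obtain ⟨x, hx⟩ := lifts_nonempty_of_infix he ⟨_, hseg⟩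
  -- A coset in the quotient need not be a vertex of the covering; x is one because the lift of
  -- f^n(e) starts with an edge of `Δ`.
  obtain ⟨l₀, hl₀, rfl⟩ := exists_isPath_of_mem_lifts (f.iter_ne_nil hg n e)
    (f.path_iterate_isPath n (CellMap.isPath_singleton Γ e)) hx
  refine index_ne_zero_of_loops hβ.hom_injective hl₀
    (lifts_finite hD (f.iter_ne_nil hg n e)) (fun k hk => ?_) hH
  -- Only loops of the form f^n(l) are known to preserve the finite set, but every loop at f^n(o(e))
  -- is homotopic to one.
  obtain ⟨l, hl, hlk⟩ := hf.homotopyEquiv.exists_loop_iterate n _ hk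
  rw [← hlk]
  exact inv_smul_mem_lifts_of_isPath (lifts_iter_eq_of_o_eq hg hW hD hc) hl rfl rfl hx
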